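/- Let $h,k\ge 0$ be integers, let $M$ be a smooth manifold of dimension $2h+2k+2$, and let $(\alpha_1,\alpha_2,\phi,g)$ be a metric contact pair of type $(h,k)$ on $M$ with decomposable $\phi$. That is (all objects being smooth, and with the convention $d\alpha(X,Y)=\tfrac12\bigl(X\alpha(Y)-Y\alpha(X)-\alpha([X,Y])\bigr)$): - $\alpha_1,\alpha_2$ are one-forms such that $\alpha_1\wedge(d\alpha_1)^h\wedge\alpha_2\wedge(d\alpha_2)^k$ is a volume form, $(d\alpha_1)^{h+1}=0$ and $(d\alpha_2)^{k+1}=0$; the Reeb vector fields $Z_1,Z_2$ are the vector fields determined by $\alpha_i(Z_j)=\delta_{ij}$ and $i_{Z_j}d\alpha_i=0$ for $i,j\in\{1,2\}$; - $\phi$ is a field of endomorphisms of $TM$ with $\phi^2=-\mathrm{Id}+\alpha_1\otimes Z_1+\alpha_2\otimes Z_2$ and $\phi Z_1=\phi Z_2=0$; - $g$ is a Riemannian metric with $g(X,\phi Y)=(d\alpha_1+d\alpha_2)(X,Y)$ and $g(X,Z_i)=\alpha_i(X)$ for $i=1,2$; - (decomposability) $\phi$ maps each of the distributions $\ker\alpha_i\cap\ker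 d\alpha_i$, $i=1,2$, into itself. Put $Z=Z_1+Z_2$ and $\mathsf h=\tfrac12\mathcal L_Z\phi$, and let $\mathrm{Ric}(Z)$ denote the Ricci curvature of $g$ in the direction of $Z$, i.e. $\mathrm{Ric}(Z)=\mathrm{Ric}_g(Z,Z)/g(Z,Z)$, the sum of the sectional curvatures of the planes spanned by $Z$ and the vectors of an orthonormal basis of $Z^\perp$. Then, at every point of $M$, $$\mathrm{Ric}(Z)=h+k-\tfrac12\operatorname{tr}\mathsf h^2 .$$ Moreover, $\mathrm{Ric}(Z)=h+k$ everywhere on $M$ if and only if $Z$ is a Killing vector field of $g$. -/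

import Mathlib

open scoped Manifold ContDiff Bundle

namespace ContactPair

noncomputable section

set_option linter.unusedSectionVars false

open Bundle FiberBundle VectorField

section

variable {E : Type*} [NormedAddCommGroup E] [NormedSpace ℝ E]
  {H : Type*} [TopologicalSpace H] {I : ModelWithCorners ℝ E H}
  {M : Type*} [TopologicalSpace M] [ChartedSpace H M]

/-- A one-form, as a section of the cotangent bundle. -/
abbrev formSection (α : Π x : M, TangentSpace I x →L[ℝ] ℝ) (x : M) :
    TotalSpace (E →L[ℝ] ℝ) (fun x : M ↦ TangentSpace I x →L[ℝ] ℝ) :=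
  TotalSpace.mk' (E →L[ℝ] ℝ) x (α x)

/-- A field of endomorphisms, as a section of the bundle `End(TM)`. -/
abbrev endSection (A : Π x : M, TangentSpace I x →L[ℝ] TangentSpace I x) (x : M) :
    TotalSpace (E →L[ℝ] E) (fun x : M ↦ TangentSpace I x →L[ℝ] TangentSpace I x) :=
  TotalSpace.mk' (E →L[ℝ] E) x (A x)

instance finiteDimensionalTangentSpace [FiniteDimensional ℝ E] (x : M) :
    FiniteDimensional ℝ (TangentSpace I x) :=
  inferInstanceAs (FiniteDimensional ℝ E)

instance t2SpaceTangentSpace (x : M) : T2Space (TangentSpace I x) :=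
  inferInstanceAs (T2Space E)

variable [IsManifold I ∞ M] [FiniteDimensional ℝ E]

/-! ### Exterior derivative of a one-form and Lie derivative of an endomorphism field -/

/-- `(X, Y) ↦ ½ (X (α Y) - Y (α X) - α [X, Y])` on vector fields, evaluated at `x`. -/
def extDerivAux (α : Π x : M, TangentSpace I x →L[ℝ] ℝ) (x : M)
    (X Y : Π x : M, TangentSpace I x) : ℝ :=
  (1 / 2 : ℝ) * (d% (fun y ↦ α y (Y y)) x (X x) - d% (fun y ↦ α y (X y)) x (Y x)
    - α x (mlieBracket I X Y x))

theorem extDerivAux_swap (α : Π x : M, TangentSpace I x →L[ℝ] ℝ) (x : M)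
    (X Y : Π x : M, TangentSpace I x) : extDerivAux α x X Y = - extDerivAux α x Y X := by
  simp only [extDerivAux]
  rw [mlieBracket_swap_apply, map_neg]
  ring

theorem mdiff_oneForm_apply {α : Π x : M, TangentSpace I x →L[ℝ] ℝ} {x : M}
    (hα : MDifferentiableAt I (I.prod 𝓘(ℝ, E →L[ℝ] ℝ)) (formSection α) x) {X : Π x : M, TangentSpace I x} (hX : MDiffAt (T% X) x) :
    MDiffAt (fun y ↦ α y (X y)) x := by
  have := MDifferentiableAt.clm_bundle_apply (F₁ := E) (F₂ := ℝ) (E₂ := Trivial M ℝ) hα hX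
  exact ((mdifferentiableAt_totalSpace _ _).1 this).2

theorem extDerivAux_tensorial_left {α : Π x : M, TangentSpace I x →L[ℝ] ℝ} {x : M}
    (hα : MDifferentiableAt I (I.prod 𝓘(ℝ, E →L[ℝ] ℝ)) (formSection α) x) (Y : Π x : M, TangentSpace I x) (_hY : MDiffAt (T% Y) x) :
    TensorialAt I E (fun X ↦ extDerivAux α x X Y) x where
  smul {f X} hf hX := by
    have h1 := mvfderiv_fun_mul hf (mdiff_oneForm_apply hα hX)
    simp only [extDerivAux, Pi.smul_apply', map_smul, smul_eq_mul, h1,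
      mlieBracket_smul_left hf hX]
    simp
    ring
  add {X X'} hX hX' := by
    have h1 := mvfderiv_fun_add (mdiff_oneForm_apply hα hX) (mdiff_oneForm_apply hα hX')
    simp only [extDerivAux, Pi.add_apply, map_add, h1, mlieBracket_add_left hX hX']
    simp
    ring

theorem extDerivAux_tensorial_right {α : Π x : M, TangentSpace I x →L[ℝ] ℝ} {x : M}
    (hα : MDifferentiableAt I (I.prod 𝓘(ℝ, E →L[ℝ] ℝ)) (formSection α) x) (X : Π x : M, TangentSpace I x) (hX : MDiffAt (T% X) x) :
    TensorialAt I E (fun Y ↦ extDerivAux α x X Y) x where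
  smul hf hY := by
    simp only [extDerivAux_swap α x X]
    rw [(extDerivAux_tensorial_left hα X hX).smul hf hY, smul_neg]
  add hY hY' := by
    simp only [extDerivAux_swap α x X]
    rw [(extDerivAux_tensorial_left hα X hX).add hY hY', neg_add]

open scoped Classical in
/-- The exterior derivative of a differentiable one-form, as a bilinear form on each tangent space,
with the normalization `dα(X, Y) = ½ (X (α Y) - Y (α X) - α [X, Y])` that is customary in contact
metric geometry. (Where `α` is not differentiable the value is `0` by convention.) -/
def extDeriv (α : Π x : M, TangentSpace I x →L[ℝ] ℝ) (x : M) :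
    TangentSpace I x →L[ℝ] TangentSpace I x →L[ℝ] ℝ :=
  if hα : MDifferentiableAt I (I.prod 𝓘(ℝ, E →L[ℝ] ℝ)) (formSection α) x then
    TensorialAt.mkHom₂ (extDerivAux α x) x (extDerivAux_tensorial_left hα)
      (extDerivAux_tensorial_right hα)
  else 0

theorem extDeriv_apply {α : Π x : M, TangentSpace I x →L[ℝ] ℝ} {x : M}
    (hα : MDifferentiableAt I (I.prod 𝓘(ℝ, E →L[ℝ] ℝ)) (formSection α) x) {X Y : Π x : M, TangentSpace I x} (hX : MDiffAt (T% X) x)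
    (hY : MDiffAt (T% Y) x) :
    extDeriv α x (X x) (Y x) =
      (1 / 2 : ℝ) * (d% (fun y ↦ α y (Y y)) x (X x) - d% (fun y ↦ α y (X y)) x (Y x)
        - α x (mlieBracket I X Y x)) := by
  rw [extDeriv, dif_pos hα]
  exact TensorialAt.mkHom₂_apply _ _ hX hY

theorem lieDerivEnd_tensorial {Z : Π x : M, TangentSpace I x}
    {A : Π x : M, TangentSpace I x →L[ℝ] TangentSpace I x} {x : M}
    (hA : MDifferentiableAt I (I.prod 𝓘(ℝ, E →L[ℝ] E)) (endSection A) x) :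
    TensorialAt I E (fun X ↦ mlieBracket I Z (fun y ↦ A y (X y)) x
      - A x (mlieBracket I Z X x)) x where
  smul {f X} hf hX := by
    have h1 : (fun y ↦ A y ((f • X) y)) = f • (fun y ↦ A y (X y)) := by
      ext y; simp
    have h2 := MDifferentiableAt.clm_bundle_apply (F₁ := E) (F₂ := E) hA hX
    simp only [h1, mlieBracket_smul_right hf h2, mlieBracket_smul_right hf hX]
    simp
    module
  add {X X'} hX hX' := by
    have h1 : (fun y ↦ A y ((X + X') y)) = (fun y ↦ A y (X y)) + (fun y ↦ A y (X' y)) := by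
      ext y; simp
    have h2 := MDifferentiableAt.clm_bundle_apply (F₁ := E) (F₂ := E) hA hX
    have h3 := MDifferentiableAt.clm_bundle_apply (F₁ := E) (F₂ := E) hA hX'
    simp only [h1, mlieBracket_add_right h2 h3, mlieBracket_add_right hX hX']
    simp
    abel

open scoped Classical in
/-- The Lie derivative `(L_Z A) X = [Z, A X] - A [Z, X]` of a differentiable field of endomorphisms
`A` along the vector field `Z`. (Where `A` is not differentiable the value is `0` by
convention.) -/
def lieDerivEnd (Z : Π x : M, TangentSpace I x)
    (A : Π x : M, TangentSpace I x →L[ℝ] TangentSpace I x) (x : M) :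
    TangentSpace I x →L[ℝ] TangentSpace I x :=
  if hA : MDifferentiableAt I (I.prod 𝓘(ℝ, E →L[ℝ] E)) (endSection A) x then
    TensorialAt.mkHom _ x (lieDerivEnd_tensorial (Z := Z) hA)
  else 0

theorem lieDerivEnd_apply (Z : Π x : M, TangentSpace I x)
    {A : Π x : M, TangentSpace I x →L[ℝ] TangentSpace I x} {x : M}
    (hA : MDifferentiableAt I (I.prod 𝓘(ℝ, E →L[ℝ] E)) (endSection A) x) {X : Π x : M, TangentSpace I x} (hX : MDiffAt (T% X) x) :
    lieDerivEnd Z A x (X x) =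
      mlieBracket I Z (fun y ↦ A y (X y)) x - A x (mlieBracket I Z X x) := by
  rw [lieDerivEnd, dif_pos hA]
  exact TensorialAt.mkHom_apply (lieDerivEnd_tensorial (Z := Z) hA) hX

/-! ### The Levi-Civita connection of a Riemannian metric -/

variable (g : ContMDiffRiemannianMetric I ∞ E (TangentSpace I : M → Type _))

theorem mdiff_metric {x : M} {X Y : Π x : M, TangentSpace I x}
    (hX : MDiffAt (T% X) x) (hY : MDiffAt (T% Y) x) :
    MDiffAt (fun y ↦ g.inner y (X y) (Y y)) x := by
  have hg := (g.contMDiff.mdifferentiable (by simp)) x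
  have := MDifferentiableAt.clm_bundle_apply₂ (F₁ := E) (F₂ := E) (F₃ := ℝ) (E₃ := Trivial M ℝ)
    hg hX hY
  exact ((mdifferentiableAt_totalSpace _ _).1 this).2

/-- The isomorphism `v ↦ g(v, ·)` of the tangent space with its dual. -/
def flat (x : M) : TangentSpace I x ≃ₗ[ℝ] (TangentSpace I x →L[ℝ] ℝ) :=
  LinearMap.linearEquivOfInjective
    (g.inner x : TangentSpace I x →ₗ[ℝ] (TangentSpace I x →L[ℝ] ℝ))
    (by
      rw [← LinearMap.ker_eq_bot, LinearMap.ker_eq_bot']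
      intro v hv
      by_contra h
      have h1 := g.pos x v h
      have h2 : g.inner x v = 0 := hv
      simp [h2] at h1)
    (by
      rw [← (LinearMap.toContinuousLinearMap :
        (TangentSpace I x →ₗ[ℝ] ℝ) ≃ₗ[ℝ] (TangentSpace I x →L[ℝ] ℝ)).finrank_eq]
      exact Subspace.dual_finrank_eq.symm)

theorem flat_apply (x : M) (v w : TangentSpace I x) : flat g x v w = g.inner x v w := rfl

/-- The right-hand side of the Koszul formula. -/
def koszul (x : M) (Y X W : Π x : M, TangentSpace I x) : ℝ :=
  d% (fun y ↦ g.inner y (Y y) (W y)) x (X x) + d% (fun y ↦ g.inner y (X y) (W y)) x (Y x)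
    - d% (fun y ↦ g.inner y (X y) (Y y)) x (W x)
    + g.inner x (mlieBracket I X Y x) (W x) - g.inner x (mlieBracket I X W x) (Y x)
    - g.inner x (mlieBracket I Y W x) (X x)

theorem koszul_tensorial_left {x : M} {Y : Π x : M, TangentSpace I x} (hY : MDiffAt (T% Y) x)
    (W : Π x : M, TangentSpace I x) (hW : MDiffAt (T% W) x) :
    TensorialAt I E (fun X ↦ koszul g x Y X W) x where
  smul {f X} hf hX := by
    have h1 := mvfderiv_fun_mul hf (mdiff_metric g hX hW)
    have h2 := mvfderiv_fun_mul hf (mdiff_metric g hX hY)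
    simp only [koszul, Pi.smul_apply', map_smul, smul_eq_mul, h1, h2, FunLike.coe_smul,
      mlieBracket_smul_left hf hX, Pi.smul_apply]
    simp [g.symm x (X x)]
    ring
  add {X X'} hX hX' := by
    have h1 := mvfderiv_fun_add (mdiff_metric g hX hW) (mdiff_metric g hX' hW)
    have h2 := mvfderiv_fun_add (mdiff_metric g hX hY) (mdiff_metric g hX' hY)
    simp only [koszul, Pi.add_apply, map_add, h1, h2, mlieBracket_add_left hX hX',
      add_apply]
    ring

theorem koszul_tensorial_right {x : M} {Y : Π x : M, TangentSpace I x} (hY : MDiffAt (T% Y) x)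
    (X : Π x : M, TangentSpace I x) (hX : MDiffAt (T% X) x) :
    TensorialAt I E (fun W ↦ koszul g x Y X W) x where
  smul {f W} hf hW := by
    have h1 := mvfderiv_fun_mul hf (mdiff_metric g hX hW)
    have h2 := mvfderiv_fun_mul hf (mdiff_metric g hY hW)
    simp only [koszul, Pi.smul_apply', map_smul, smul_eq_mul, h1, h2,
      mlieBracket_smul_right hf hW]
    simp [g.symm x (Y x) (W x), g.symm x (X x)]
    ring
  add {W W'} hW hW' := by
    have h1 := mvfderiv_fun_add (mdiff_metric g hX hW) (mdiff_metric g hX hW')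
    have h2 := mvfderiv_fun_add (mdiff_metric g hY hW) (mdiff_metric g hY hW')
    simp only [koszul, Pi.add_apply, map_add, h1, h2, mlieBracket_add_right hW hW',
      add_apply]
    ring

open scoped Classical in
/-- The Levi-Civita connection on differentiable vector fields: `∇_X Y` is determined by
`2 g(∇_X Y, W) = koszul(Y, X, W)`. -/
def leviCivitaFun (Y : Π x : M, TangentSpace I x) (x : M) :
    TangentSpace I x →L[ℝ] TangentSpace I x :=
  if hY : MDiffAt (T% Y) x then
    LinearMap.toContinuousLinearMap ((1 / 2 : ℝ) • ((flat g x).symm.toLinearMap ∘ₗ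
      (TensorialAt.mkHom₂ (koszul g x Y) x (koszul_tensorial_left g hY)
        (koszul_tensorial_right g hY)).toLinearMap))
  else 0

theorem inner_leviCivitaFun {x : M} {Y X W : Π x : M, TangentSpace I x}
    (hY : MDiffAt (T% Y) x) (hX : MDiffAt (T% X) x) (hW : MDiffAt (T% W) x) :
    g.inner x (leviCivitaFun g Y x (X x)) (W x) = (1 / 2 : ℝ) * koszul g x Y X W := by
  rw [leviCivitaFun, dif_pos hY, ← flat_apply]
  simp only [LinearMap.coe_toContinuousLinearMap', LinearMap.comp_apply,
    LinearEquiv.coe_coe, map_smul, LinearEquiv.apply_symm_apply, smul_apply, smul_eq_mul]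
  congr 1
  exact TensorialAt.mkHom₂_apply _ _ hX hW

theorem eq_of_inner_eq {x : M} {u v : TangentSpace I x}
    (h : ∀ W : Π x : M, TangentSpace I x, MDiffAt (T% W) x →
      g.inner x u (W x) = g.inner x v (W x)) : u = v := by
  apply (flat g x).injective
  ext w
  have := h (extend E w) (mdifferentiableAt_extend ..)
  rwa [extend_apply_self] at this

theorem hom_ext_field {x : M} {A B : TangentSpace I x →L[ℝ] TangentSpace I x}
    (h : ∀ X : Π x : M, TangentSpace I x, MDiffAt (T% X) x → A (X x) = B (X x)) : A = B := by
  ext w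
  have := h (extend E w) (mdifferentiableAt_extend ..)
  rwa [extend_apply_self] at this

/-- The Levi-Civita connection of the Riemannian metric `g`. -/
def leviCivita : CovariantDerivative I E (TangentSpace I : M → Type _) where
  toFun := leviCivitaFun g
  isCovariantDerivativeOnUniv :=
    { add := by
        intro Y Y' x hY hY' _
        refine hom_ext_field fun X hX ↦ eq_of_inner_eq g fun W hW ↦ ?_
        have h1 := mvfderiv_fun_add (mdiff_metric g hY hW) (mdiff_metric g hY' hW)
        have h2 := mvfderiv_fun_add (mdiff_metric g hX hY) (mdiff_metric g hX hY')
        rw [inner_leviCivitaFun g (mdifferentiableAt_add_section hY hY') hX hW, add_apply,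
          map_add, add_apply, inner_leviCivitaFun g hY hX hW, inner_leviCivitaFun g hY' hX hW]
        simp only [koszul, Pi.add_apply, map_add, h1, h2, mlieBracket_add_right hY hY',
          mlieBracket_add_left hY hY', add_apply]
        ring
      leibniz := by
        intro Y f x hY hf _
        refine hom_ext_field fun X hX ↦ eq_of_inner_eq g fun W hW ↦ ?_
        have h1 := mvfderiv_fun_mul hf (mdiff_metric g hY hW)
        have h2 := mvfderiv_fun_mul hf (mdiff_metric g hX hY)
        have hfY : MDiffAt (T% (f • Y)) x := hf.smul_section hY
        rw [inner_leviCivitaFun g hfY hX hW, add_apply, map_add, add_apply, smul_apply, map_smul,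
          smul_apply, inner_leviCivitaFun g hY hX hW]
        simp only [koszul, Pi.smul_apply', map_smul, smul_eq_mul, h1, h2, smul_apply,
          mlieBracket_smul_right hf hY, mlieBracket_smul_left hf hY]
        simp [g.symm x (X x) (Y x)]
        ring }

theorem leviCivita_torsionFree {x : M} {X Y : Π x : M, TangentSpace I x}
    (hX : MDiffAt (T% X) x) (hY : MDiffAt (T% Y) x) :
    leviCivita g Y x (X x) - leviCivita g X x (Y x) = mlieBracket I X Y x := by
  refine eq_of_inner_eq g fun W hW ↦ ?_
  have h1 := inner_leviCivitaFun g hY hX hW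
  have h2 := inner_leviCivitaFun g hX hY hW
  change g.inner x (leviCivitaFun g Y x (X x) - leviCivitaFun g X x (Y x)) (W x) = _
  rw [map_sub, sub_apply, h1, h2]
  simp only [koszul, mlieBracket_swap_apply (V := Y) (W := X), g.symm _ (Y _) (X _)]
  simp
  ring

theorem leviCivita_metric {x : M} {X Y W : Π x : M, TangentSpace I x}
    (hX : MDiffAt (T% X) x) (hY : MDiffAt (T% Y) x) (hW : MDiffAt (T% W) x) :
    d% (fun y ↦ g.inner y (Y y) (W y)) x (X x) =
      g.inner x (leviCivita g Y x (X x)) (W x) + g.inner x (Y x) (leviCivita g W x (X x)) := by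
  have h1 := inner_leviCivitaFun g hY hX hW
  have h2 := inner_leviCivitaFun g hW hX hY
  change _ = g.inner x (leviCivitaFun g Y x (X x)) (W x)
    + g.inner x (Y x) (leviCivitaFun g W x (X x))
  rw [g.symm x (Y x), h1, h2]
  simp only [koszul, mlieBracket_swap_apply (V := W) (W := Y), g.symm _ (W _) (Y _)]
  simp
  ring

/-! ### Curvature, Ricci curvature, Killing fields -/

/-- The curvature `R(X, Y) V = ∇_X ∇_Y V - ∇_Y ∇_X V - ∇_[X, Y] V` on vector fields. -/
def curvature (X Y V : Π x : M, TangentSpace I x) (x : M) : TangentSpace I x :=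
  leviCivita g (fun y ↦ leviCivita g V y (Y y)) x (X x)
    - leviCivita g (fun y ↦ leviCivita g V y (X y)) x (Y x)
    - leviCivita g V x (mlieBracket I X Y x)

theorem curvature_tensorial {x : M} {Y V : Π x : M, TangentSpace I x}
    (hV : MDifferentiableAt I (I.prod 𝓘(ℝ, E →L[ℝ] E)) (endSection (leviCivita g V)) x) :
    TensorialAt I E (fun X ↦ curvature g X Y V x) x where
  smul {f X} hf hX := by
    have h1 : (fun y ↦ leviCivita g V y ((f • X) y)) = f • (fun y ↦ leviCivita g V y (X y)) := by
      ext y; simp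
    have h2 := MDifferentiableAt.clm_bundle_apply (F₁ := E) (F₂ := E) hV hX
    simp only [curvature, h1, mlieBracket_smul_left hf hX,
      (leviCivita g).isCovariantDerivativeOnUniv.leibniz h2 hf]
    simp
    module
  add {X X'} hX hX' := by
    have h1 : (fun y ↦ leviCivita g V y ((X + X') y)) =
        (fun y ↦ leviCivita g V y (X y)) + (fun y ↦ leviCivita g V y (X' y)) := by
      ext y; simp
    have h2 := MDifferentiableAt.clm_bundle_apply (F₁ := E) (F₂ := E) hV hX
    have h3 := MDifferentiableAt.clm_bundle_apply (F₁ := E) (F₂ := E) hV hX'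
    simp only [curvature, h1, mlieBracket_add_left hX hX',
      (leviCivita g).isCovariantDerivativeOnUniv.add h2 h3]
    simp
    module

open scoped Classical in
/-- The endomorphism `u ↦ R(u, Y) V` of the tangent space at `x`, for vector fields `Y` and `V`
such that the tensor field `∇V` is differentiable at `x` (otherwise `0` by convention). -/
def curvatureEnd (Y V : Π x : M, TangentSpace I x) (x : M) :
    TangentSpace I x →L[ℝ] TangentSpace I x :=
  if hV : MDifferentiableAt I (I.prod 𝓘(ℝ, E →L[ℝ] E)) (endSection (leviCivita g V)) x then
    TensorialAt.mkHom _ x (curvature_tensorial (Y := Y) g hV)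
  else 0

theorem curvatureEnd_apply {Y V : Π x : M, TangentSpace I x} {x : M}
    (hV : MDifferentiableAt I (I.prod 𝓘(ℝ, E →L[ℝ] E)) (endSection (leviCivita g V)) x)
    {X : Π x : M, TangentSpace I x} (hX : MDiffAt (T% X) x) :
    curvatureEnd g Y V x (X x) = curvature g X Y V x := by
  rw [curvatureEnd, dif_pos hV]
  exact TensorialAt.mkHom_apply (curvature_tensorial (Y := Y) g hV) hX

/-- The trace of an endomorphism of the tangent space. -/
def tr {x : M} (A : TangentSpace I x →L[ℝ] TangentSpace I x) : ℝ :=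
  LinearMap.trace ℝ (TangentSpace I x) A.toLinearMap

/-- The Ricci tensor `Ric(Y, V) = tr (u ↦ R(u, Y) V)`. -/
def ricciTensor (Y V : Π x : M, TangentSpace I x) (x : M) : ℝ :=
  tr (curvatureEnd g Y V x)

/-- The Ricci curvature in the direction of a nowhere zero vector field `V`, that is
`Ric(V, V) / g(V, V)`; equivalently, the sum of the sectional curvatures `K(V, X_i)` over an
orthonormal basis `X_i` of the orthogonal complement of `V`. -/
def ricciCurvature (V : Π x : M, TangentSpace I x) (x : M) : ℝ :=
  ricciTensor g V V x / g.inner x (V x) (V x)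

/-- `V` is a Killing field: `(L_V g)(X, Y) = V (g(X, Y)) - g([V, X], Y) - g(X, [V, Y])` vanishes
for all (locally defined) smooth vector fields `X` and `Y`. -/
def IsKilling (V : Π x : M, TangentSpace I x) : Prop :=
  ∀ (x : M) (X Y : Π x : M, TangentSpace I x), CMDiffAt ∞ (T% X) x → CMDiffAt ∞ (T% Y) x →
    d% (fun y ↦ g.inner y (X y) (Y y)) x (V x)
      - g.inner x (mlieBracket I V X x) (Y x) - g.inner x (X x) (mlieBracket I V Y x) = 0

/-! ### Metric contact pairs -/

/-- A covector as an element of degree one of the exterior algebra of the cotangent space. -/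
def extOne {x : M} (a : TangentSpace I x →L[ℝ] ℝ) :
    ExteriorAlgebra ℝ (Module.Dual ℝ (TangentSpace I x)) :=
  ExteriorAlgebra.ι ℝ a.toLinearMap

/-- An alternating bilinear form `θ` as the element `½ ∑ᵢⱼ θ(eᵢ, eⱼ) eⁱ ∧ eʲ` of degree two of the
exterior algebra of the cotangent space. -/
def extTwo {x : M} (θ : TangentSpace I x →L[ℝ] TangentSpace I x →L[ℝ] ℝ) :
    ExteriorAlgebra ℝ (Module.Dual ℝ (TangentSpace I x)) :=
  let e := Module.finBasis ℝ (TangentSpace I x)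
  (1 / 2 : ℝ) • ∑ i, ∑ j, θ (e i) (e j) •
    (ExteriorAlgebra.ι ℝ (e.coord i) * ExteriorAlgebra.ι ℝ (e.coord j))

/-- `(α₁, α₂)` is a contact pair of type `(h, k)` on a manifold of dimension `2h + 2k + 2`. -/
structure IsContactPair (h k : ℕ) (α₁ α₂ : Π x : M, TangentSpace I x →L[ℝ] ℝ) : Prop where
  finrank_eq : Module.finrank ℝ E = 2 * h + 2 * k + 2
  smooth₁ : ContMDiff I (I.prod 𝓘(ℝ, E →L[ℝ] ℝ)) ∞ (formSection α₁)
  smooth₂ : ContMDiff I (I.prod 𝓘(ℝ, E →L[ℝ] ℝ)) ∞ (formSection α₂)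
  volume : ∀ x, extOne (α₁ x) * extTwo (extDeriv α₁ x) ^ h *
    (extOne (α₂ x) * extTwo (extDeriv α₂ x) ^ k) ≠ 0
  pow₁ : ∀ x, extTwo (extDeriv α₁ x) ^ (h + 1) = 0
  pow₂ : ∀ x, extTwo (extDeriv α₂ x) ^ (k + 1) = 0

/-- `Z₁`, `Z₂` are the Reeb vector fields of the pair `(α₁, α₂)`. -/
structure IsReebPair (α₁ α₂ : Π x : M, TangentSpace I x →L[ℝ] ℝ)
    (Z₁ Z₂ : Π x : M, TangentSpace I x) : Prop where
  smooth₁ : CMDiff ∞ (T% Z₁)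
  smooth₂ : CMDiff ∞ (T% Z₂)
  apply₁₁ : ∀ x, α₁ x (Z₁ x) = 1
  apply₂₂ : ∀ x, α₂ x (Z₂ x) = 1
  apply₁₂ : ∀ x, α₁ x (Z₂ x) = 0
  apply₂₁ : ∀ x, α₂ x (Z₁ x) = 0
  contract₁₁ : ∀ x, extDeriv α₁ x (Z₁ x) = 0
  contract₁₂ : ∀ x, extDeriv α₁ x (Z₂ x) = 0
  contract₂₁ : ∀ x, extDeriv α₂ x (Z₁ x) = 0
  contract₂₂ : ∀ x, extDeriv α₂ x (Z₂ x) = 0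

/-- `(α₁, α₂, φ)` is a contact pair structure of type `(h, k)` with Reeb vector fields
`Z₁`, `Z₂`. -/
structure IsContactPairStructure (h k : ℕ) (α₁ α₂ : Π x : M, TangentSpace I x →L[ℝ] ℝ)
    (φ : Π x : M, TangentSpace I x →L[ℝ] TangentSpace I x)
    (Z₁ Z₂ : Π x : M, TangentSpace I x) : Prop where
  contactPair : IsContactPair h k α₁ α₂
  reeb : IsReebPair α₁ α₂ Z₁ Z₂
  smooth : ContMDiff I (I.prod 𝓘(ℝ, E →L[ℝ] E)) ∞ (endSection φ)
  sq : ∀ x (v : TangentSpace I x), φ x (φ x v) = -v + α₁ x v • Z₁ x + α₂ x v • Z₂ x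
  apply_reeb₁ : ∀ x, φ x (Z₁ x) = 0
  apply_reeb₂ : ∀ x, φ x (Z₂ x) = 0

/-- `(α₁, α₂, φ, g)` is a metric contact pair of type `(h, k)` with Reeb vector fields
`Z₁`, `Z₂`. -/
structure IsMetricContactPair (h k : ℕ) (α₁ α₂ : Π x : M, TangentSpace I x →L[ℝ] ℝ)
    (φ : Π x : M, TangentSpace I x →L[ℝ] TangentSpace I x)
    (g : ContMDiffRiemannianMetric I ∞ E (TangentSpace I : M → Type _))
    (Z₁ Z₂ : Π x : M, TangentSpace I x) : Prop where
  contactPairStructure : IsContactPairStructure h k α₁ α₂ φ Z₁ Z₂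
  inner_φ : ∀ x (u v : TangentSpace I x),
    g.inner x u (φ x v) = extDeriv α₁ x u v + extDeriv α₂ x u v
  inner_reeb₁ : ∀ x (v : TangentSpace I x), g.inner x v (Z₁ x) = α₁ x v
  inner_reeb₂ : ∀ x (v : TangentSpace I x), g.inner x v (Z₂ x) = α₂ x v

/-- The characteristic distribution `ker α ∩ ker dα` of a one-form. -/
def charDistribution (α : Π x : M, TangentSpace I x →L[ℝ] ℝ) (x : M) :
    Submodule ℝ (TangentSpace I x) :=
  LinearMap.ker (α x).toLinearMap ⊓ LinearMap.ker (extDeriv α x).toLinearMap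

/-- `φ` is decomposable: it preserves the characteristic distributions of `α₁` and `α₂`. -/
def IsDecomposable (α₁ α₂ : Π x : M, TangentSpace I x →L[ℝ] ℝ)
    (φ : Π x : M, TangentSpace I x →L[ℝ] TangentSpace I x) : Prop :=
  ∀ x, (∀ v ∈ charDistribution α₁ x, φ x v ∈ charDistribution α₁ x) ∧
    (∀ v ∈ charDistribution α₂ x, φ x v ∈ charDistribution α₂ x)

/-- The tensor field `½ L_Z φ`. -/
def hTensor (φ : Π x : M, TangentSpace I x →L[ℝ] TangentSpace I x)
    (Z : Π x : M, TangentSpace I x) (x : M) : TangentSpace I x →L[ℝ] TangentSpace I x :=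
  (1 / 2 : ℝ) • lieDerivEnd Z φ x

end

end

end ContactPair

/-!
Write `Z = Z₁ + Z₂`, `A = ∇Z` and `𝗁 = ½ L_Z φ`. The one-form `α₁ + α₂` is metrically dual to `Z`
and its exterior derivative is `g(·, φ ·)`, so the Koszul formula splits `A` as `A = -φ + S`, where
`-φ` is skew and the symmetric part `S` satisfies `L_Z g = 2 g(S ·, ·)`
(`two_mul_inner_leviCivita`, `two_mul_inner_symmPart`). In particular `Z` is Killing exactly when
`S = 0`.

The Lie derivatives along `Z` of `αᵢ`, `dαᵢ` and `Zᵢ` vanish (`mvfderiv_inner_φ`,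
`mlieBracket_reeb`). Together with `g(·, φ ·) = dα₁ + dα₂` this gives `𝗁 = -S φ` (`hTensor_eq`), and
together with `φ² = -1 + α₁ ⊗ Z₁ + α₂ ⊗ Z₂` it gives `𝗁 φ = -φ 𝗁` (`hTensor_anticomm`). Since `S`
vanishes on the Reeb fields, `S = 𝗁 φ`, hence `S² = 𝗁²` and `A² = 𝗁² + φ²`.

The integral curves of `Z` are geodesics, and the curvature is given by the Riccati equation
`R(·, Z) Z = -L_Z A - A²` (`curvatureEnd_reeb`). Lie differentiation of `A φ + φ A = -2 φ²` shows
that `L_Z A` anticommutes with `φ`, and `L_Z A` vanishes on the Reeb fields, so that it has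
trace zero (`trace_eq_zero_of_anticomm`). Hence
`Ric(Z, Z) = -tr A² = -tr 𝗁² - tr φ² = 2h + 2k - tr 𝗁²`, while `g(Z, Z) = 2`. Finally
`tr 𝗁² = tr S²` is the squared norm of the symmetric operator `S`, which vanishes only if `S = 0`.

The formula `A = -φ + 𝗁 φ` also shows that `∇Z` is a differentiable tensor field: it maps smooth
fields to combinations of Lie brackets (`mdifferentiableAt_endSection`, `mdiff_leviCivita_reeb`).
-/

open scoped Manifold ContDiff Bundle

namespace ContactPair

noncomputable section

set_option linter.unusedSectionVars false

open Bundle FiberBundle VectorField Filter Topology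

/-! ### Traces of endomorphisms -/

section

/-- If `B` anticommutes with `φ`, then `B φ²` has trace zero, because its trace is also that of
`φ B φ = -B φ²`. -/
theorem trace_eq_zero_of_anticomm {V : Type*} [AddCommGroup V] [Module ℝ V]
    [FiniteDimensional ℝ V] {B φ : V →ₗ[ℝ] V} (hanti : ∀ v, B (φ v) = - φ (B v))
    (hB : ∀ v, B (φ (φ v)) = - B v) :
    LinearMap.trace ℝ V B = 0 := by
  have h1 : B = - (B ∘ₗ φ) ∘ₗ φ := by ext v; simp [hB]
  have h2 : B = φ ∘ₗ (B ∘ₗ φ) := by ext v; simp [← neg_eq_iff_eq_neg.2 (hanti _), hB]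
  have h3 := congrArg (LinearMap.trace ℝ V) h1
  have h4 := congrArg (LinearMap.trace ℝ V) h2
  rw [LinearMap.trace_comp_comm'] at h4
  rw [map_neg] at h3
  linarith

/-- For an operator that is self-adjoint for the inner product `b`, the trace of `S²` is
`∑ᵢ b (S eᵢ) (S eᵢ)` over an orthonormal basis. -/
theorem eq_zero_of_trace_sq_eq_zero {V : Type*} [AddCommGroup V] [Module ℝ V]
    [FiniteDimensional ℝ V] (b : V →ₗ[ℝ] V →ₗ[ℝ] ℝ) (hb : ∀ u v, b u v = b v u)
    (hpos : ∀ v, v ≠ 0 → 0 < b v v) {S : V →ₗ[ℝ] V} (hS : ∀ u v, b (S u) v = b u (S v))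
    (htr : LinearMap.trace ℝ V (S ∘ₗ S) = 0) : S = 0 := by
  let core : InnerProductSpace.Core ℝ V :=
    { inner := fun u v ↦ b u v
      conj_inner_symm := fun u v ↦ by simpa using hb v u
      re_inner_nonneg := fun v ↦ by
        rcases eq_or_ne v 0 with rfl | hv
        · simp
        · simpa using (hpos v hv).le
      add_left := fun u v w ↦ by simp
      smul_left := fun u v r ↦ by simp
      definite := fun v hv ↦ by
        by_contra h
        exact (hpos v h).ne' hv }
  let _ : NormedAddCommGroup V := core.toNormedAddCommGroup
  let _ : InnerProductSpace ℝ V := InnerProductSpace.ofCore core.toCore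
  have hin : ∀ u v : V, inner ℝ u v = b u v := fun _ _ ↦ rfl
  let e := stdOrthonormalBasis ℝ V
  rw [LinearMap.trace_eq_sum_inner _ e] at htr
  have h1 : ∀ i, inner ℝ (e i) ((S ∘ₗ S) (e i)) = inner ℝ (S (e i)) (S (e i)) := fun i ↦ by
    simp only [hin, LinearMap.comp_apply, hS]
  simp only [h1] at htr
  rw [Finset.sum_eq_zero_iff_of_nonneg fun i _ ↦ real_inner_self_nonneg] at htr
  refine e.toBasis.ext fun i ↦ ?_
  simpa using htr i (Finset.mem_univ i)

end

section

variable {E : Type*} [NormedAddCommGroup E] [NormedSpace ℝ E]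
  {H : Type*} [TopologicalSpace H] {I : ModelWithCorners ℝ E H}
  {M : Type*} [TopologicalSpace M] [ChartedSpace H M] [IsManifold I ∞ M]

/-! ### Lie brackets and regularity of sections -/

theorem contMDiffAt_mvfderiv_apply {f : M → ℝ} {x : M} {X : Π x : M, TangentSpace I x}
    (hf : CMDiffAt 2 f x) (hX : CMDiffAt 1 (T% X) x) :
    CMDiffAt 1 (fun y ↦ d% f y (X y)) x := by
  have h1 : CMDiffAt 1 (inTangentCoordinates I 𝓘(ℝ, ℝ) id f (mfderiv% f) x) x :=
    hf.mfderiv_const (by norm_num)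
  have h2 := ContMDiffAt.clm_apply_of_inCoordinates (F₁ := E) (F₂ := ℝ) (E₁ := TangentSpace I)
    (E₂ := TangentSpace 𝓘(ℝ, ℝ)) (b₁ := id) (b₂ := f) (ϕ := fun y ↦ mfderiv% f y) h1 hX
    (hf.of_le (by norm_num))
  have h3 := (contMDiffAt_totalSpace.1 h2).2
  refine h3.congr_of_eventuallyEq (Eventually.of_forall fun y ↦ ?_)
  simp [mvfderiv]
  rfl

variable [FiniteDimensional ℝ E]

theorem contMDiffAt_mlieBracket {x : M} {X Y : Π x : M, TangentSpace I x}
    (hX : CMDiffAt 2 (T% X) x) (hY : CMDiffAt 2 (T% Y) x) :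
    CMDiffAt 1 (T% (mlieBracket I X Y)) x := by
  have : IsManifold I (((2 : ℕ∞) : ℕ∞ω) + 1) M := IsManifold.of_le
    (n := ∞) (by exact_mod_cast le_top)
  have : IsManifold I (minSmoothness ℝ 2) M :=
    IsManifold.of_le (n := ∞) (by simpa using ENat.LEInfty.out)
  have : CompleteSpace E := FiniteDimensional.complete ℝ E
  exact ContMDiffAt.mlieBracket_vectorField (m := 1) (n := 2) hX hY (by simp; norm_num)

/-- The Lie bracket acts on functions as the commutator of derivations. The formula is read off
from the Jacobi identity for `X`, `Y` and `f • W`, where `W` is a field that does not vanish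
at `x`: the terms that do not cancel are multiples of `W`. -/
theorem mvfderiv_mlieBracket_apply {f : M → ℝ} {x : M} {X Y : Π x : M, TangentSpace I x}
    (hf : CMDiffAt 2 f x) (hX : CMDiffAt 2 (T% X) x) (hY : CMDiffAt 2 (T% Y) x) :
    d% f x (mlieBracket I X Y x) =
      d% (fun y ↦ d% f y (Y y)) x (X x) - d% (fun y ↦ d% f y (X y)) x (Y x) := by
  rcases subsingleton_or_nontrivial E with hE | hE
  · have h0 : ∀ v : TangentSpace I x, v = 0 := fun v ↦ Subsingleton.elim (α := E) v 0
    rw [h0 (mlieBracket I X Y x), h0 (X x), h0 (Y x)]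
    simp
  have : CompleteSpace E := FiniteDimensional.complete ℝ E
  have : IsManifold I (minSmoothness ℝ 3) M :=
    IsManifold.of_le (n := ∞) (by simpa using ENat.LEInfty.out)
  obtain ⟨w, hw⟩ := exists_ne (0 : E)
  set W : Π x : M, TangentSpace I x := extend E (show TangentSpace I x from w)
  have hWx : W x = w := extend_apply_self ..
  have hW : CMDiffAt 2 (T% W) x := contMDiffAt_extend ..
  have hfW : CMDiffAt 2 (T% (f • W)) x := hf.smul_section hW
  have key : ∀ {V : Π x : M, TangentSpace I x}, CMDiffAt 2 (T% V) x →
      mlieBracket I V (f • W) =ᶠ[𝓝 x] (fun y ↦ d% f y (V y)) • W + f • mlieBracket I V W := by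
    intro V _
    filter_upwards [contMDiffAt_iff_contMDiffAt_nhds (by simp) |>.1 hf,
      contMDiffAt_iff_contMDiffAt_nhds (by simp) |>.1 hW] with y hfy hWy
    rw [mlieBracket_smul_right (hfy.mdifferentiableAt (by simp)) (hWy.mdifferentiableAt (by simp))]
    rfl
  have two : ∀ {U V : Π x : M, TangentSpace I x}, CMDiffAt 2 (T% U) x → CMDiffAt 2 (T% V) x →
      mlieBracket I U (mlieBracket I V (f • W)) x =
        d% (fun y ↦ d% f y (V y)) x (U x) • W x + d% f x (V x) • mlieBracket I U W x
        + (d% f x (U x) • mlieBracket I V W x + f x • mlieBracket I U (mlieBracket I V W) x) := by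
    intro U V hU hV
    have hVf := (contMDiffAt_mvfderiv_apply hf (hV.of_le one_le_two)).mdifferentiableAt one_ne_zero
    have hVW := (contMDiffAt_mlieBracket hV hW).mdifferentiableAt one_ne_zero
    have hW1 := hW.mdifferentiableAt two_ne_zero
    have hf1 := hf.mdifferentiableAt two_ne_zero
    rw [EventuallyEq.rfl.mlieBracket_vectorField_eq (key hV),
      mlieBracket_add_right (hVf.smul_section hW1) (hf1.smul_section hVW),
      mlieBracket_smul_right hVf hW1, mlieBracket_smul_right hf1 hVW]
  have jac : ∀ {V : Π x : M, TangentSpace I x}, CMDiffAt 2 (T% V) x →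
      mlieBracket I X (mlieBracket I Y V) x =
        mlieBracket I (mlieBracket I X Y) V x + mlieBracket I Y (mlieBracket I X V) x :=
    fun hV ↦ leibniz_identity_mlieBracket_apply (by simpa using hX) (by simpa using hY)
      (by simpa using hV)
  have h1 := jac hfW
  rw [two hX hY, two hY hX, (mlieBracket_smul_right (hf.mdifferentiableAt two_ne_zero)
    (hW.mdifferentiableAt two_ne_zero)), jac hW] at h1
  have h2 : (d% f x (mlieBracket I X Y x) -
      (d% (fun y ↦ d% f y (Y y)) x (X x) - d% (fun y ↦ d% f y (X y)) x (Y x))) • W x = 0 := by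
    rw [sub_smul, sub_smul]
    have h3 := sub_eq_zero.2 h1
    rw [← neg_eq_zero, ← h3]
    module
  rw [hWx] at h2
  rcases smul_eq_zero.1 h2 with h3 | h3
  · exact sub_eq_zero.1 h3
  · exact absurd h3 hw

/-- A field of endomorphisms is differentiable if it maps `C²` fields to differentiable ones: these
include the fields of a local frame, whose images are the columns of its matrix. -/
theorem mdifferentiableAt_endSection
    {A : Π x : M, TangentSpace I x →L[ℝ] TangentSpace I x} {x : M}
    (hA : ∀ X : Π x : M, TangentSpace I x, CMDiffAt 2 (T% X) x →
      MDiffAt (T% (fun y ↦ A y (X y))) x) :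
    MDifferentiableAt I (I.prod 𝓘(ℝ, E →L[ℝ] E)) (endSection A) x := by
  rw [mdifferentiableAt_hom_bundle]
  refine ⟨mdifferentiableAt_id, ?_⟩
  let b := Module.finBasis ℝ E
  let e := trivializationAt E (TangentSpace I : M → Type _) x
  have hmem : ∀ᶠ y in 𝓝 x, y ∈ e.baseSet :=
    e.open_baseSet.mem_nhds (FiberBundle.mem_baseSet_trivializationAt' x)
  -- the local frame, constant in the trivialization at `x`
  let X (i) : Π y : M, TangentSpace I y := fun y ↦ e.symm y (b i)
  have hX : ∀ i, CMDiffAt 2 (T% (X i)) x := by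
    intro i
    have h := contMDiffAt_extend (k := 2) I E (e.symm x (b i))
    refine h.congr_of_eventuallyEq (Eventually.of_forall fun y ↦ ?_)
    simp only [X, extend, TotalSpace.mk_inj]
    congr 1
    exact (congrArg Prod.snd (e.apply_mk_symm (FiberBundle.mem_baseSet_trivializationAt' x) _)).symm
  let L (i) : E →L[ℝ] (E →L[ℝ] E) :=
    ContinuousLinearMap.smulRightL ℝ E E (LinearMap.toContinuousLinearMap (b.coord i))
  have hF : MDiffAt (∑ i, fun y ↦ L i (e ⟨y, A y (X i y)⟩).2) x := by
    have h1 : ∀ i, MDiffAt (fun y ↦ (e ⟨y, A y (X i y)⟩).2) x := fun i ↦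
      ((mdifferentiableAt_totalSpace _ _).1 (hA (X i) (hX i))).2
    exact MDifferentiableAt.sum fun i _ ↦
      (L i).differentiableAt.comp_mdifferentiableAt (h1 i)
  refine hF.congr_of_eventuallyEq ?_
  filter_upwards [hmem] with y hy
  have hT : ∀ w : E, ContinuousLinearMap.inCoordinates E (TangentSpace I : M → Type _) E
      (TangentSpace I : M → Type _) x y x y (A y) w = (e ⟨y, A y (e.symm y w)⟩).2 := by
    intro w
    rw [ContinuousLinearMap.inCoordinates_eq hy hy]
    simp [e]
  ext v
  change ContinuousLinearMap.inCoordinates E (TangentSpace I : M → Type _) E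
      (TangentSpace I : M → Type _) x y x y (A y) v = _
  conv_lhs => rw [← b.sum_repr v, map_sum]
  refine (Finset.sum_congr rfl fun i _ ↦
    (ContinuousLinearMap.map_smul _ _ _).trans (congrArg _ (hT _))).trans ?_
  simp [L, X]

/-! ### Exterior and Lie derivatives of one-forms -/

theorem contMDiffAt_oneForm_apply {n : ℕ∞ω} {α : Π x : M, TangentSpace I x →L[ℝ] ℝ} {x : M}
    (hα : ContMDiffAt I (I.prod 𝓘(ℝ, E →L[ℝ] ℝ)) n (formSection α) x)
    {X : Π x : M, TangentSpace I x} (hX : CMDiffAt n (T% X) x) :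
    CMDiffAt n (fun y ↦ α y (X y)) x := by
  have := ContMDiffAt.clm_bundle_apply (F₁ := E) (F₂ := ℝ) (E₂ := Trivial M ℝ) hα hX
  exact (contMDiffAt_totalSpace.1 this).2

theorem extDeriv_swap (α : Π x : M, TangentSpace I x →L[ℝ] ℝ) (x : M) (u v : TangentSpace I x) :
    extDeriv α x u v = - extDeriv α x v u := by
  by_cases hα : MDifferentiableAt I (I.prod 𝓘(ℝ, E →L[ℝ] ℝ)) (formSection α) x
  · have hu := mdifferentiableAt_extend I E u
    have hv := mdifferentiableAt_extend I E v
    have h1 := extDeriv_apply hα hu hv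
    have h2 := extDeriv_apply hα hv hu
    simp only [extend_apply_self] at h1 h2
    rw [h1, h2, mlieBracket_swap_apply, map_neg]
    ring
  · simp [extDeriv, hα]

/-- If `α(V)` is constant and `i_V dα = 0`, then `L_V α = 0`, that is `V (α Y) = α [V, Y]`. -/
theorem mvfderiv_oneForm_apply {α : Π x : M, TangentSpace I x →L[ℝ] ℝ} {x : M}
    (hα : MDifferentiableAt I (I.prod 𝓘(ℝ, E →L[ℝ] ℝ)) (formSection α) x)
    {V Y : Π x : M, TangentSpace I x} (hV : MDiffAt (T% V) x) (hY : MDiffAt (T% Y) x) {c : ℝ}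
    (hc : ∀ y, α y (V y) = c) (hd : extDeriv α x (V x) = 0) :
    d% (fun y ↦ α y (Y y)) x (V x) = α x (mlieBracket I V Y x) := by
  have h := extDeriv_apply hα hV hY
  simp only [hd, hc, mvfderiv_const] at h
  simp at h
  linarith

/-- If `L_V α = 0`, then `L_V dα = 0`, because the two derivatives commute. -/
theorem mvfderiv_extDeriv_apply {α : Π x : M, TangentSpace I x →L[ℝ] ℝ}
    (hα : ContMDiff I (I.prod 𝓘(ℝ, E →L[ℝ] ℝ)) ∞ (formSection α))
    {V : Π x : M, TangentSpace I x} (hV : CMDiff ∞ (T% V))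
    (hL : ∀ (y : M) (Y : Π x : M, TangentSpace I x), MDiffAt (T% Y) y →
      d% (fun y ↦ α y (Y y)) y (V y) = α y (mlieBracket I V Y y))
    {x : M} {X Y : Π x : M, TangentSpace I x} (hX : CMDiffAt 2 (T% X) x)
    (hY : CMDiffAt 2 (T% Y) x) :
    d% (fun y ↦ extDeriv α y (X y) (Y y)) x (V x) =
      extDeriv α x (mlieBracket I V X x) (Y x) + extDeriv α x (X x) (mlieBracket I V Y x) := by
  have hα1 : ∀ y, MDifferentiableAt I (I.prod 𝓘(ℝ, E →L[ℝ] ℝ)) (formSection α) y :=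
    fun y ↦ (hα y).mdifferentiableAt (by simp)
  have hα2 : ContMDiffAt I (I.prod 𝓘(ℝ, E →L[ℝ] ℝ)) 2 (formSection α) x :=
    (hα x).of_le ENat.LEInfty.out
  have hV2 : CMDiffAt 2 (T% V) x := (hV x).of_le ENat.LEInfty.out
  have near : ∀ {W : Π x : M, TangentSpace I x}, CMDiffAt 2 (T% W) x →
      ∀ᶠ y in 𝓝 x, MDiffAt (T% W) y := fun hW ↦ by
    filter_upwards [(contMDiffAt_iff_contMDiffAt_nhds (by simp)).1 hW] with y hy
    exact hy.mdifferentiableAt two_ne_zero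
  have hXY := (contMDiffAt_mlieBracket hX hY).mdifferentiableAt one_ne_zero
  have hVX := (contMDiffAt_mlieBracket hV2 hX).mdifferentiableAt one_ne_zero
  have hVY := (contMDiffAt_mlieBracket hV2 hY).mdifferentiableAt one_ne_zero
  have hαX := contMDiffAt_oneForm_apply hα2 hX
  have hαY := contMDiffAt_oneForm_apply hα2 hY
  have hX1 := hX.mdifferentiableAt two_ne_zero
  have hY1 := hY.mdifferentiableAt two_ne_zero
  have hXαY := (contMDiffAt_mvfderiv_apply hαY (hX.of_le one_le_two)).mdifferentiableAt one_ne_zero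
  have hYαX := (contMDiffAt_mvfderiv_apply hαX (hY.of_le one_le_two)).mdifferentiableAt one_ne_zero
  have hαXY := mdiff_oneForm_apply (hα1 x) hXY
  have e1 : (fun y ↦ extDeriv α y (X y) (Y y)) =ᶠ[𝓝 x] (fun _ ↦ (1 / 2 : ℝ)) *
      ((fun y ↦ d% (fun z ↦ α z (Y z)) y (X y)) - (fun y ↦ d% (fun z ↦ α z (X z)) y (Y y))
        - fun y ↦ α y (mlieBracket I X Y y)) := by
    filter_upwards [near hX, near hY] with y h1 h2
    exact extDeriv_apply (hα1 y) h1 h2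
  -- the hypothesis `L_V α = 0` on the fields near `x`, ready to be differentiated once more
  have e2 : ∀ {W : Π x : M, TangentSpace I x}, CMDiffAt 2 (T% W) x →
      (fun y ↦ d% (fun z ↦ α z (W z)) y (V y)) =ᶠ[𝓝 x] fun y ↦ α y (mlieBracket I V W y) := by
    intro W hW
    filter_upwards [near hW] with y hy using hL y W hy
  have c1 := mvfderiv_mlieBracket_apply hαY hV2 hX
  have c2 := mvfderiv_mlieBracket_apply hαX hV2 hY
  have cong : ∀ {a b : M → ℝ}, a =ᶠ[𝓝 x] b → d% a x = d% b x := by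
    intro a b h
    simp only [mvfderiv, h.mfderiv_eq]
    congr 1
  have : CompleteSpace E := FiniteDimensional.complete ℝ E
  have : IsManifold I (minSmoothness ℝ 3) M :=
    IsManifold.of_le (n := ∞) (by simpa using ENat.LEInfty.out)
  have jac := leibniz_identity_mlieBracket_apply (I := I) (by simpa using hV2) (by simpa using hX)
    (by simpa using hY)
  have hs1 := hXαY.sub hYαX
  have hs2 := hs1.sub hαXY
  rw [cong e1, extDeriv_apply (hα1 x) hVX hY1, extDeriv_apply (hα1 x) hX1 hVY,
    ← cong (e2 hX), ← cong (e2 hY), mvfderiv_mul mdifferentiableAt_const hs2,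
    mvfderiv_sub hs1 hαXY, mvfderiv_sub hXαY hYαX]
  simp only [mvfderiv_const, add_apply, smul_apply, sub_apply, smul_eq_mul, hL x _ hXY, jac,
    map_add, c1, c2]
  simp
  ring

theorem mdifferentiableAt_formSection_add {α β : Π x : M, TangentSpace I x →L[ℝ] ℝ} {x : M}
    (hα : MDifferentiableAt I (I.prod 𝓘(ℝ, E →L[ℝ] ℝ)) (formSection α) x)
    (hβ : MDifferentiableAt I (I.prod 𝓘(ℝ, E →L[ℝ] ℝ)) (formSection β) x) :
    MDifferentiableAt I (I.prod 𝓘(ℝ, E →L[ℝ] ℝ)) (formSection (α + β)) x :=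
  mdifferentiableAt_add_section hα hβ

theorem extDeriv_add {α β : Π x : M, TangentSpace I x →L[ℝ] ℝ} {x : M}
    (hα : MDifferentiableAt I (I.prod 𝓘(ℝ, E →L[ℝ] ℝ)) (formSection α) x)
    (hβ : MDifferentiableAt I (I.prod 𝓘(ℝ, E →L[ℝ] ℝ)) (formSection β) x) :
    extDeriv (α + β) x = extDeriv α x + extDeriv β x := by
  ext u v
  have hu := mdifferentiableAt_extend I E u
  have hv := mdifferentiableAt_extend I E v
  have h1 := extDeriv_apply (mdifferentiableAt_formSection_add hα hβ) hu hv
  have h2 := extDeriv_apply hα hu hv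
  have h3 := extDeriv_apply hβ hu hv
  simp only [Pi.add_apply, add_apply, mvfderiv_fun_add (mdiff_oneForm_apply hα hv)
    (mdiff_oneForm_apply hβ hv), mvfderiv_fun_add (mdiff_oneForm_apply hα hu)
    (mdiff_oneForm_apply hβ hu)] at h1
  simp only [extend_apply_self] at h1 h2 h3
  rw [h1, add_apply, add_apply, h2, h3]
  ring

/-! ### The symmetric part of the covariant derivative -/

/-- For the one-form `α` dual to `Z`, the Koszul formula reads
`2 g(∇_X Z, W) = 2 dα(X, W) + (L_Z g)(X, W)`; this is the splitting of `∇Z` into its skew and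
symmetric parts. -/
theorem two_mul_inner_leviCivita
    (g : ContMDiffRiemannianMetric I ∞ E (TangentSpace I : M → Type _)) {x : M}
    {Z X W : Π x : M, TangentSpace I x}
    {α : Π x : M, TangentSpace I x →L[ℝ] ℝ} (hαZ : ∀ y v, g.inner y v (Z y) = α y v)
    (hα : MDifferentiableAt I (I.prod 𝓘(ℝ, E →L[ℝ] ℝ)) (formSection α) x)
    (hZ : MDiffAt (T% Z) x) (hX : MDiffAt (T% X) x) (hW : MDiffAt (T% W) x) :
    2 * g.inner x (leviCivita g Z x (X x)) (W x) = 2 * extDeriv α x (X x) (W x) +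
      (d% (fun y ↦ g.inner y (X y) (W y)) x (Z x)
      - g.inner x (mlieBracket I Z X x) (W x) - g.inner x (X x) (mlieBracket I Z W x)) := by
  have h1 := inner_leviCivitaFun g hZ hX hW
  have h2 := extDeriv_apply hα hX hW
  change 2 * g.inner x (leviCivitaFun g Z x (X x)) (W x) = _
  rw [h1, h2]
  simp only [koszul, g.symm _ (Z _) (W _), hαZ,
    mlieBracket_swap_apply (V := X) (W := Z), g.symm x (X x) (mlieBracket I Z W x)]
  simp
  ring

/-- The sum of the covariant derivative `∇Z` and of `φ`; on a metric contact pair, the symmetric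
part of `∇Z`. -/
def symmPart (φ : Π x : M, TangentSpace I x →L[ℝ] TangentSpace I x)
    (g : ContMDiffRiemannianMetric I ∞ E (TangentSpace I : M → Type _))
    (Z : Π x : M, TangentSpace I x) (x : M) : TangentSpace I x →L[ℝ] TangentSpace I x :=
  leviCivita g Z x + φ x

theorem two_mul_hTensor_apply {φ : Π x : M, TangentSpace I x →L[ℝ] TangentSpace I x}
    (Z : Π x : M, TangentSpace I x) {x : M}
    (hφ : MDifferentiableAt I (I.prod 𝓘(ℝ, E →L[ℝ] E)) (endSection φ) x)
    {X : Π x : M, TangentSpace I x} (hX : MDiffAt (T% X) x) :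
    (2 : ℝ) • hTensor φ Z x (X x) =
      mlieBracket I Z (fun y ↦ φ y (X y)) x - φ x (mlieBracket I Z X x) := by
  rw [hTensor, smul_apply, lieDerivEnd_apply Z hφ hX, smul_smul]
  norm_num

theorem eq_zero_of_inner_eq_zero
    (g : ContMDiffRiemannianMetric I ∞ E (TangentSpace I : M → Type _)) {x : M}
    {u : TangentSpace I x} (hu : ∀ v, g.inner x u v = 0) : u = 0 := by
  by_contra h
  exact (g.pos x u h).ne' (hu u)

theorem tr_add {x : M} (A B : TangentSpace I x →L[ℝ] TangentSpace I x) :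
    tr (A + B) = tr A + tr B := by
  simp [tr]

theorem tr_neg {x : M} (A : TangentSpace I x →L[ℝ] TangentSpace I x) : tr (-A) = -tr A := by
  simp [tr]

/-! ### Lie derivatives along the Reeb fields -/

variable {h k : ℕ} {α₁ α₂ : Π x : M, TangentSpace I x →L[ℝ] ℝ}
  {φ : Π x : M, TangentSpace I x →L[ℝ] TangentSpace I x}
  {g : ContMDiffRiemannianMetric I ∞ E (TangentSpace I : M → Type _)}
  {Z₁ Z₂ : Π x : M, TangentSpace I x}

namespace IsReebPair

theorem smooth_add (hZ : IsReebPair α₁ α₂ Z₁ Z₂) : CMDiff ∞ (T% (Z₁ + Z₂)) :=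
  hZ.smooth₁.add_section hZ.smooth₂

end IsReebPair

namespace IsMetricContactPair

theorem reeb (hM : IsMetricContactPair h k α₁ α₂ φ g Z₁ Z₂) : IsReebPair α₁ α₂ Z₁ Z₂ :=
  hM.contactPairStructure.reeb

theorem mdiff₁ (hM : IsMetricContactPair h k α₁ α₂ φ g Z₁ Z₂) (x : M) :
    MDifferentiableAt I (I.prod 𝓘(ℝ, E →L[ℝ] ℝ)) (formSection α₁) x :=
  (hM.contactPairStructure.contactPair.smooth₁ x).mdifferentiableAt (by simp)

theorem mdiff₂ (hM : IsMetricContactPair h k α₁ α₂ φ g Z₁ Z₂) (x : M) :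
    MDifferentiableAt I (I.prod 𝓘(ℝ, E →L[ℝ] ℝ)) (formSection α₂) x :=
  (hM.contactPairStructure.contactPair.smooth₂ x).mdifferentiableAt (by simp)

theorem mdiff_φ (hM : IsMetricContactPair h k α₁ α₂ φ g Z₁ Z₂) (x : M) :
    MDifferentiableAt I (I.prod 𝓘(ℝ, E →L[ℝ] E)) (endSection φ) x :=
  (hM.contactPairStructure.smooth x).mdifferentiableAt (by simp)

theorem mdiff_φ_apply (hM : IsMetricContactPair h k α₁ α₂ φ g Z₁ Z₂) {x : M}
    {X : Π x : M, TangentSpace I x} (hX : MDiffAt (T% X) x) :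
    MDiffAt (T% (fun y ↦ φ y (X y))) x :=
  MDifferentiableAt.clm_bundle_apply (F₁ := E) (F₂ := E) (hM.mdiff_φ x) hX

theorem contMDiffAt_φ_apply (hM : IsMetricContactPair h k α₁ α₂ φ g Z₁ Z₂) {x : M}
    {X : Π x : M, TangentSpace I x} (hX : CMDiffAt 2 (T% X) x) :
    CMDiffAt 2 (T% (fun y ↦ φ y (X y))) x :=
  ContMDiffAt.clm_bundle_apply (F₁ := E) (F₂ := E)
    ((hM.contactPairStructure.smooth x).of_le ENat.LEInfty.out) hX

theorem mdiff_reeb (hM : IsMetricContactPair h k α₁ α₂ φ g Z₁ Z₂) (x : M) :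
    MDiffAt (T% (Z₁ + Z₂)) x :=
  (hM.reeb.smooth_add x).mdifferentiableAt (by simp)

theorem mdiff_reeb₁ (hM : IsMetricContactPair h k α₁ α₂ φ g Z₁ Z₂) (x : M) : MDiffAt (T% Z₁) x :=
  (hM.reeb.smooth₁ x).mdifferentiableAt (by simp)

theorem mdiff_reeb₂ (hM : IsMetricContactPair h k α₁ α₂ φ g Z₁ Z₂) (x : M) : MDiffAt (T% Z₂) x :=
  (hM.reeb.smooth₂ x).mdifferentiableAt (by simp)

theorem inner_φ_left (hM : IsMetricContactPair h k α₁ α₂ φ g Z₁ Z₂) (x : M)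
    (u v : TangentSpace I x) : g.inner x (φ x u) v = - g.inner x u (φ x v) := by
  rw [g.symm, hM.inner_φ, hM.inner_φ, extDeriv_swap α₁ x v, extDeriv_swap α₂ x v]
  ring

/-- The Lie derivative of the two-form `g(·, φ ·) = d(α₁ + α₂)` vanishes along a field `V` in the
kernel of `dα₁` and of `dα₂` on which `α₁ + α₂` is constant. -/
theorem mvfderiv_inner_φ (hM : IsMetricContactPair h k α₁ α₂ φ g Z₁ Z₂)
    {V : Π x : M, TangentSpace I x} (hV : CMDiff ∞ (T% V)) {c : ℝ}
    (hc : ∀ y, α₁ y (V y) + α₂ y (V y) = c) (hd₁ : ∀ y, extDeriv α₁ y (V y) = 0)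
    (hd₂ : ∀ y, extDeriv α₂ y (V y) = 0) {x : M} {X Y : Π x : M, TangentSpace I x}
    (hX : CMDiffAt 2 (T% X) x) (hY : CMDiffAt 2 (T% Y) x) :
    d% (fun y ↦ g.inner y (X y) (φ y (Y y))) x (V x) =
      g.inner x (mlieBracket I V X x) (φ x (Y x)) +
        g.inner x (X x) (φ x (mlieBracket I V Y x)) := by
  have hα : ContMDiff I (I.prod 𝓘(ℝ, E →L[ℝ] ℝ)) ∞ (formSection (α₁ + α₂)) :=
    hM.contactPairStructure.contactPair.smooth₁.add_section
      hM.contactPairStructure.contactPair.smooth₂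
  have hd : ∀ y, extDeriv (α₁ + α₂) y = extDeriv α₁ y + extDeriv α₂ y := fun y ↦
    extDeriv_add (hM.mdiff₁ y) (hM.mdiff₂ y)
  have h1 := mvfderiv_extDeriv_apply hα hV (fun y Y hY ↦ mvfderiv_oneForm_apply
    ((hα y).mdifferentiableAt (by simp)) ((hV y).mdifferentiableAt (by simp)) hY hc
    (by simp [hd, hd₁, hd₂])) hX hY
  simpa only [hd, add_apply, ← hM.inner_φ] using h1

theorem mvfderiv_oneForm₁ (hM : IsMetricContactPair h k α₁ α₂ φ g Z₁ Z₂) (x : M)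
    {Y : Π x : M, TangentSpace I x} (hY : MDiffAt (T% Y) x) :
    d% (fun y ↦ α₁ y (Y y)) x ((Z₁ + Z₂) x) = α₁ x (mlieBracket I (Z₁ + Z₂) Y x) :=
  mvfderiv_oneForm_apply (hM.mdiff₁ x) (hM.mdiff_reeb x) hY (c := 1)
    (fun y ↦ by simp [hM.reeb.apply₁₁, hM.reeb.apply₁₂])
    (by simp [hM.reeb.contract₁₁, hM.reeb.contract₁₂])

theorem mvfderiv_oneForm₂ (hM : IsMetricContactPair h k α₁ α₂ φ g Z₁ Z₂) (x : M)
    {Y : Π x : M, TangentSpace I x} (hY : MDiffAt (T% Y) x) :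
    d% (fun y ↦ α₂ y (Y y)) x ((Z₁ + Z₂) x) = α₂ x (mlieBracket I (Z₁ + Z₂) Y x) :=
  mvfderiv_oneForm_apply (hM.mdiff₂ x) (hM.mdiff_reeb x) hY (c := 1)
    (fun y ↦ by simp [hM.reeb.apply₂₁, hM.reeb.apply₂₂])
    (by simp [hM.reeb.contract₂₁, hM.reeb.contract₂₂])

/-- The Reeb fields commute: `[Z₁, Z₂]` is in the kernel of `g(·, φ ·)`, hence of `φ`, and `α₁`
and `α₂` vanish on it. -/
theorem mlieBracket_reeb (hM : IsMetricContactPair h k α₁ α₂ φ g Z₁ Z₂) (x : M) :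
    mlieBracket I Z₁ Z₂ x = 0 := by
  have hZ := hM.reeb
  have hs := hM.contactPairStructure
  have hZ2 : CMDiffAt 2 (T% Z₂) x := (hZ.smooth₂ x).of_le ENat.LEInfty.out
  have hφ : φ x (mlieBracket I Z₁ Z₂ x) = 0 := by
    refine eq_zero_of_inner_eq_zero g fun v ↦ ?_
    have hv := contMDiffAt_extend (k := 2) I E v
    have h1 := hM.mvfderiv_inner_φ hZ.smooth₁ (c := 1)
      (fun y ↦ by simp [hZ.apply₁₁, hZ.apply₂₁]) hZ.contract₁₁ hZ.contract₂₁ hZ2 hv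
    simp only [hM.inner_φ, hZ.contract₁₂, hZ.contract₂₂, zero_apply, mvfderiv_const, add_zero,
      extend_apply_self] at h1
    rw [hM.inner_φ_left, hM.inner_φ, ← h1, neg_zero]
  have h1 := mvfderiv_oneForm_apply (hM.mdiff₁ x) (hM.mdiff_reeb₁ x) (hM.mdiff_reeb₂ x)
    hZ.apply₁₁ (hZ.contract₁₁ x)
  have h2 := mvfderiv_oneForm_apply (hM.mdiff₂ x) (hM.mdiff_reeb₁ x) (hM.mdiff_reeb₂ x)
    hZ.apply₂₁ (hZ.contract₂₁ x)
  simp only [hZ.apply₁₂, hZ.apply₂₂, mvfderiv_const, zero_apply] at h1 h2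
  have h3 := hs.sq x (mlieBracket I Z₁ Z₂ x)
  rw [hφ, ← h1, ← h2] at h3
  simpa using h3

theorem mlieBracket_reeb₁ (hM : IsMetricContactPair h k α₁ α₂ φ g Z₁ Z₂) (x : M) :
    mlieBracket I (Z₁ + Z₂) Z₁ x = 0 := by
  rw [mlieBracket_add_left (hM.mdiff_reeb₁ x) (hM.mdiff_reeb₂ x), mlieBracket_self,
    mlieBracket_swap_apply, hM.mlieBracket_reeb]
  simp

theorem mlieBracket_reeb₂ (hM : IsMetricContactPair h k α₁ α₂ φ g Z₁ Z₂) (x : M) :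
    mlieBracket I (Z₁ + Z₂) Z₂ x = 0 := by
  rw [mlieBracket_add_left (hM.mdiff_reeb₁ x) (hM.mdiff_reeb₂ x), mlieBracket_self,
    hM.mlieBracket_reeb]
  simp

/-- The Lie derivative of the metric is `L_Z g = 2 g(S ·, ·)`, where `S` is the symmetric part
of `∇Z`. -/
theorem two_mul_inner_symmPart (hM : IsMetricContactPair h k α₁ α₂ φ g Z₁ Z₂) {x : M}
    {X W : Π x : M, TangentSpace I x} (hX : MDiffAt (T% X) x) (hW : MDiffAt (T% W) x) :
    2 * g.inner x (symmPart φ g (Z₁ + Z₂) x (X x)) (W x) =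
      d% (fun y ↦ g.inner y (X y) (W y)) x ((Z₁ + Z₂) x)
        - g.inner x (mlieBracket I (Z₁ + Z₂) X x) (W x)
        - g.inner x (X x) (mlieBracket I (Z₁ + Z₂) W x) := by
  have h1 := two_mul_inner_leviCivita g (Z := Z₁ + Z₂) (α := α₁ + α₂)
    (fun y v ↦ by simp [hM.inner_reeb₁, hM.inner_reeb₂])
    (mdifferentiableAt_formSection_add (hM.mdiff₁ x) (hM.mdiff₂ x)) (hM.mdiff_reeb x) hX hW
  rw [extDeriv_add (hM.mdiff₁ x) (hM.mdiff₂ x), add_apply, add_apply, ← hM.inner_φ] at h1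
  rw [symmPart, add_apply, map_add, add_apply, mul_add, h1, hM.inner_φ_left]
  ring

theorem symmPart_symm (hM : IsMetricContactPair h k α₁ α₂ φ g Z₁ Z₂) (x : M)
    (u v : TangentSpace I x) :
    g.inner x (symmPart φ g (Z₁ + Z₂) x u) v = g.inner x u (symmPart φ g (Z₁ + Z₂) x v) := by
  have hu := mdifferentiableAt_extend I E u
  have hv := mdifferentiableAt_extend I E v
  have h1 := hM.two_mul_inner_symmPart hu hv
  have h2 := hM.two_mul_inner_symmPart hv hu
  simp only [g.symm _ (extend E v _) (extend E u _), extend_apply_self] at h1 h2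
  rw [g.symm x _ u, g.symm x (mlieBracket I _ (extend E v) x), g.symm x v] at h2
  linarith

theorem symmPart_reeb₁ (hM : IsMetricContactPair h k α₁ α₂ φ g Z₁ Z₂) (x : M) :
    symmPart φ g (Z₁ + Z₂) x (Z₁ x) = 0 := by
  refine eq_zero_of_inner_eq_zero g fun v ↦ ?_
  have hv := mdifferentiableAt_extend I E v
  have h1 := hM.two_mul_inner_symmPart (hM.mdiff_reeb₁ x) hv
  simp only [g.symm _ (Z₁ _) _, hM.inner_reeb₁, hM.mlieBracket_reeb₁,
    hM.mvfderiv_oneForm₁ x hv, extend_apply_self] at h1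
  simpa using h1

theorem symmPart_reeb₂ (hM : IsMetricContactPair h k α₁ α₂ φ g Z₁ Z₂) (x : M) :
    symmPart φ g (Z₁ + Z₂) x (Z₂ x) = 0 := by
  refine eq_zero_of_inner_eq_zero g fun v ↦ ?_
  have hv := mdifferentiableAt_extend I E v
  have h1 := hM.two_mul_inner_symmPart (hM.mdiff_reeb₂ x) hv
  simp only [g.symm _ (Z₂ _) _, hM.inner_reeb₂, hM.mlieBracket_reeb₂,
    hM.mvfderiv_oneForm₂ x hv, extend_apply_self] at h1
  simpa using h1

/-- The relation `½ L_Z φ = -S φ`, which is the Lie derivative of `g(·, φ ·) = dα₁ + dα₂`: the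
right-hand side of this equation is invariant along `Z`, and `L_Z g = 2 g(S ·, ·)`. -/
theorem hTensor_eq (hM : IsMetricContactPair h k α₁ α₂ φ g Z₁ Z₂) (x : M) (v : TangentSpace I x) :
    hTensor φ (Z₁ + Z₂) x v = - symmPart φ g (Z₁ + Z₂) x (φ x v) := by
  rw [← add_eq_zero_iff_eq_neg]
  refine eq_zero_of_inner_eq_zero g fun u ↦ ?_
  have hu := contMDiffAt_extend (k := 2) I E u
  have hv := contMDiffAt_extend (k := 2) I E v
  have hu1 := hu.mdifferentiableAt two_ne_zero
  have hv1 := hv.mdifferentiableAt two_ne_zero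
  have h1 := hM.mvfderiv_inner_φ hM.reeb.smooth_add (c := 2)
    (fun y ↦ by norm_num [hM.reeb.apply₁₁, hM.reeb.apply₂₁, hM.reeb.apply₁₂, hM.reeb.apply₂₂])
    (fun y ↦ by simp [hM.reeb.contract₁₁, hM.reeb.contract₁₂])
    (fun y ↦ by simp [hM.reeb.contract₂₁, hM.reeb.contract₂₂]) hu hv
  have h3 := hM.two_mul_inner_symmPart hu1 (hM.mdiff_φ_apply hv1)
  have h4 := congrArg (g.inner x u) (two_mul_hTensor_apply (Z₁ + Z₂) (hM.mdiff_φ x) hv1)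
  rw [h1] at h3
  simp only [extend_apply_self, map_smul, map_sub, smul_eq_mul] at h3 h4
  rw [g.symm, map_add, ← hM.symmPart_symm]
  linarith

/-- The Lie derivative along `Z` of `φ² = -1 + α₁ ⊗ Z₁ + α₂ ⊗ Z₂` vanishes, because it vanishes
on each of the factors. -/
theorem mlieBracket_φ_φ (hM : IsMetricContactPair h k α₁ α₂ φ g Z₁ Z₂) {x : M}
    {X : Π x : M, TangentSpace I x} (hX : MDiffAt (T% X) x) :
    mlieBracket I (Z₁ + Z₂) (fun y ↦ φ y (φ y (X y))) x =
      φ x (φ x (mlieBracket I (Z₁ + Z₂) X x)) := by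
  have hs := hM.contactPairStructure
  have hα₁ := mdiff_oneForm_apply (hM.mdiff₁ x) hX
  have hα₂ := mdiff_oneForm_apply (hM.mdiff₂ x) hX
  have e : (fun y ↦ φ y (φ y (X y))) = (-1 : ℝ) • X +
      (fun y ↦ α₁ y (X y)) • Z₁ + (fun y ↦ α₂ y (X y)) • Z₂ := by
    ext1 y
    simp [hs.sq]
  have m1 := hα₁.smul_section (hM.mdiff_reeb₁ x)
  have m2 := hα₂.smul_section (hM.mdiff_reeb₂ x)
  have m3 : MDiffAt (T% ((-1 : ℝ) • X : Π y : M, TangentSpace I y)) x :=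
    MDifferentiableAt.smul_const_section hX
  rw [e, mlieBracket_add_right (mdifferentiableAt_add_section m3 m1) m2,
    mlieBracket_add_right m3 m1,
    mlieBracket_const_smul_right hX, mlieBracket_smul_right hα₁ (hM.mdiff_reeb₁ x),
    mlieBracket_smul_right hα₂ (hM.mdiff_reeb₂ x), hM.mlieBracket_reeb₁, hM.mlieBracket_reeb₂,
    hs.sq, hM.mvfderiv_oneForm₁ x hX, hM.mvfderiv_oneForm₂ x hX]
  simp

/-- The tensor `½ L_Z φ` anticommutes with `φ`, because `L_Z φ² = 0`. -/
theorem hTensor_anticomm (hM : IsMetricContactPair h k α₁ α₂ φ g Z₁ Z₂) (x : M)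
    (v : TangentSpace I x) :
    hTensor φ (Z₁ + Z₂) x (φ x v) = - φ x (hTensor φ (Z₁ + Z₂) x v) := by
  have hv := mdifferentiableAt_extend I E v
  have h1 := two_mul_hTensor_apply (Z₁ + Z₂) (hM.mdiff_φ x) hv
  have h2 := two_mul_hTensor_apply (Z₁ + Z₂) (hM.mdiff_φ x) (hM.mdiff_φ_apply hv)
  have h4 := congrArg (φ x) h1
  simp only [map_smul, map_sub, extend_apply_self] at h2 h4
  rw [hM.mlieBracket_φ_φ hv] at h2
  rw [← add_eq_zero_iff_eq_neg]
  have h5 : (2 : ℝ) • (hTensor φ (Z₁ + Z₂) x (φ x v) + φ x (hTensor φ (Z₁ + Z₂) x v)) = 0 := by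
    rw [smul_add, h2, h4]
    abel
  exact (smul_eq_zero.1 h5).resolve_left two_ne_zero

/-! ### The Riccati equation along the Reeb direction -/

/-- On endomorphisms that vanish on the Reeb fields, composition with `φ²` is a change of sign. -/
theorem map_φ_φ (hM : IsMetricContactPair h k α₁ α₂ φ g Z₁ Z₂) {x : M}
    {B : TangentSpace I x →L[ℝ] TangentSpace I x} (h₁ : B (Z₁ x) = 0) (h₂ : B (Z₂ x) = 0)
    (v : TangentSpace I x) : B (φ x (φ x v)) = - B v := by
  rw [hM.contactPairStructure.sq]
  simp [h₁, h₂]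

theorem symmPart_apply (hM : IsMetricContactPair h k α₁ α₂ φ g Z₁ Z₂) (x : M)
    (v : TangentSpace I x) :
    symmPart φ g (Z₁ + Z₂) x v = hTensor φ (Z₁ + Z₂) x (φ x v) := by
  rw [hM.hTensor_eq, hM.map_φ_φ (hM.symmPart_reeb₁ x) (hM.symmPart_reeb₂ x), neg_neg]

theorem leviCivita_reeb_apply (hM : IsMetricContactPair h k α₁ α₂ φ g Z₁ Z₂) (x : M)
    (v : TangentSpace I x) :
    leviCivita g (Z₁ + Z₂) x v = hTensor φ (Z₁ + Z₂) x (φ x v) - φ x v := by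
  rw [← hM.symmPart_apply, symmPart, add_apply, add_sub_cancel_right]

theorem leviCivita_reeb₁ (hM : IsMetricContactPair h k α₁ α₂ φ g Z₁ Z₂) (x : M) :
    leviCivita g (Z₁ + Z₂) x (Z₁ x) = 0 := by
  simp [hM.leviCivita_reeb_apply, hM.contactPairStructure.apply_reeb₁]

theorem leviCivita_reeb₂ (hM : IsMetricContactPair h k α₁ α₂ φ g Z₁ Z₂) (x : M) :
    leviCivita g (Z₁ + Z₂) x (Z₂ x) = 0 := by
  simp [hM.leviCivita_reeb_apply, hM.contactPairStructure.apply_reeb₂]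

/-- The tensor field `∇Z` is differentiable, so that `curvatureEnd` and `lieDerivEnd` do not take
their default value `0` on it. By `leviCivita_reeb_apply`, `∇_X Z` is a combination of Lie brackets
of smooth fields. -/
theorem mdiff_leviCivita_reeb (hM : IsMetricContactPair h k α₁ α₂ φ g Z₁ Z₂) (x : M) :
    MDifferentiableAt I (I.prod 𝓘(ℝ, E →L[ℝ] E)) (endSection (leviCivita g (Z₁ + Z₂))) x := by
  refine mdifferentiableAt_endSection fun X hX ↦ ?_
  have hZ : CMDiffAt 2 (T% (Z₁ + Z₂)) x := (hM.reeb.smooth_add x).of_le ENat.LEInfty.out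
  have hφX := hM.contMDiffAt_φ_apply hX
  have hφφX := hM.contMDiffAt_φ_apply hφX
  have h1 := (contMDiffAt_mlieBracket hZ hφφX).mdifferentiableAt one_ne_zero
  have h2 := hM.mdiff_φ_apply ((contMDiffAt_mlieBracket hZ hφX).mdifferentiableAt one_ne_zero)
  have h3 := MDifferentiableAt.smul_const_section (a := (1 / 2 : ℝ))
    (mdifferentiableAt_sub_section h1 h2)
  refine (mdifferentiableAt_sub_section h3
    (hφX.mdifferentiableAt two_ne_zero)).congr_of_eventuallyEq ?_
  filter_upwards [(contMDiffAt_iff_contMDiffAt_nhds (by simp)).1 hφX] with y hy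
  have h4 := two_mul_hTensor_apply (Z₁ + Z₂) (hM.mdiff_φ y) (hy.mdifferentiableAt two_ne_zero)
  simp only [TotalSpace.mk_inj, hM.leviCivita_reeb_apply, Pi.sub_apply, Pi.smul_apply, ← h4,
    smul_smul]
  norm_num

/-- The Riccati equation `R(·, Z) Z = -L_Z A - A²` for `A = ∇Z`. It uses that `∇_Z Z = 0`. -/
theorem curvatureEnd_reeb (hM : IsMetricContactPair h k α₁ α₂ φ g Z₁ Z₂) (x : M) :
    curvatureEnd g (Z₁ + Z₂) (Z₁ + Z₂) x =
      - lieDerivEnd (Z₁ + Z₂) (leviCivita g (Z₁ + Z₂)) x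
        - leviCivita g (Z₁ + Z₂) x ∘L leviCivita g (Z₁ + Z₂) x := by
  refine hom_ext_field fun X hX ↦ ?_
  have hA := hM.mdiff_leviCivita_reeb x
  have hAX : MDiffAt (T% (fun y ↦ leviCivita g (Z₁ + Z₂) y (X y))) x :=
    MDifferentiableAt.clm_bundle_apply (F₁ := E) (F₂ := E) hA hX
  -- the integral curves of `Z` are geodesics
  have hgeo : (fun y ↦ leviCivita g (Z₁ + Z₂) y ((Z₁ + Z₂) y)) = 0 := by
    ext1 y
    simp [hM.leviCivita_reeb₁, hM.leviCivita_reeb₂]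
  have ht := leviCivita_torsionFree g (hM.mdiff_reeb x) hAX
  rw [curvatureEnd_apply g hA hX, curvature, hgeo, CovariantDerivative.zero, sub_apply, neg_apply,
    lieDerivEnd_apply _ hA hX, ← ht, mlieBracket_swap_apply (V := X)]
  simp only [Pi.zero_apply, zero_apply, map_neg, ContinuousLinearMap.comp_apply]
  abel

theorem lieDerivEnd_leviCivita_reeb₁ (hM : IsMetricContactPair h k α₁ α₂ φ g Z₁ Z₂) (x : M) :
    lieDerivEnd (Z₁ + Z₂) (leviCivita g (Z₁ + Z₂)) x (Z₁ x) = 0 := by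
  rw [lieDerivEnd_apply _ (hM.mdiff_leviCivita_reeb x) (hM.mdiff_reeb₁ x)]
  simp only [hM.leviCivita_reeb₁, hM.mlieBracket_reeb₁, map_zero, sub_zero]
  exact congrFun mlieBracket_zero_right x

theorem lieDerivEnd_leviCivita_reeb₂ (hM : IsMetricContactPair h k α₁ α₂ φ g Z₁ Z₂) (x : M) :
    lieDerivEnd (Z₁ + Z₂) (leviCivita g (Z₁ + Z₂)) x (Z₂ x) = 0 := by
  rw [lieDerivEnd_apply _ (hM.mdiff_leviCivita_reeb x) (hM.mdiff_reeb₂ x)]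
  simp only [hM.leviCivita_reeb₂, hM.mlieBracket_reeb₂, map_zero, sub_zero]
  exact congrFun mlieBracket_zero_right x

/-- The Lie derivative of `A = ∇Z` along `Z` anticommutes with `φ`. This is the derivative of
`A φ + φ A = -2 φ²`, since `L_Z φ = 2 𝗁` and `𝗁` anticommutes with `A`. -/
theorem lieDerivEnd_leviCivita_anticomm (hM : IsMetricContactPair h k α₁ α₂ φ g Z₁ Z₂) (x : M)
    (v : TangentSpace I x) :
    lieDerivEnd (Z₁ + Z₂) (leviCivita g (Z₁ + Z₂)) x (φ x v) =
      - φ x (lieDerivEnd (Z₁ + Z₂) (leviCivita g (Z₁ + Z₂)) x v) := by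
  have hA := hM.mdiff_leviCivita_reeb x
  have hX := mdifferentiableAt_extend I E v
  set X : Π y : M, TangentSpace I y := extend E v
  have hXv : X x = v := extend_apply_self ..
  have hφX := hM.mdiff_φ_apply hX
  have hAX : MDiffAt (T% (fun y ↦ leviCivita g (Z₁ + Z₂) y (X y))) x :=
    MDifferentiableAt.clm_bundle_apply (F₁ := E) (F₂ := E) hA hX
  have hAφX : MDiffAt (T% (fun y ↦ leviCivita g (Z₁ + Z₂) y (φ y (X y)))) x :=
    MDifferentiableAt.clm_bundle_apply (F₁ := E) (F₂ := E) hA hφX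
  have h1 := lieDerivEnd_apply (Z₁ + Z₂) hA hX
  have h2 := lieDerivEnd_apply (Z₁ + Z₂) hA hφX
  have h3 := two_mul_hTensor_apply (Z₁ + Z₂) (hM.mdiff_φ x) hAX
  have h4 := two_mul_hTensor_apply (Z₁ + Z₂) (hM.mdiff_φ x) hX
  -- `A φ + φ A = -2 φ²`, because `A + φ = 𝗁 φ` anticommutes with `φ`
  have h5 : (fun y ↦ leviCivita g (Z₁ + Z₂) y (φ y (X y))) +
      (fun y ↦ φ y (leviCivita g (Z₁ + Z₂) y (X y))) = (-2 : ℝ) • (fun y ↦ φ y (φ y (X y))) := by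
    ext1 y
    simp only [Pi.add_apply, Pi.smul_apply, hM.leviCivita_reeb_apply, map_sub, hM.hTensor_anticomm]
    module
  have h6 := mlieBracket_add_right (V := Z₁ + Z₂) hAφX (hM.mdiff_φ_apply hAX)
  rw [h5, mlieBracket_const_smul_right (hM.mdiff_φ_apply hφX), hM.mlieBracket_φ_φ hX] at h6
  have h7 := congrArg (φ x) h1
  simp only [hXv, map_sub] at h1 h2 h3 h4 h7
  have h8 := sub_eq_iff_eq_add.1 h3.symm
  have h9 := sub_eq_iff_eq_add.1 h4.symm
  rw [h9] at h2
  rw [h8] at h6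
  rw [h2, h7, eq_sub_of_add_eq h6.symm]
  simp only [hM.leviCivita_reeb_apply, map_sub, map_add, hM.hTensor_anticomm, map_smul, map_neg]
  module

/-! ### Ricci curvature and Killing fields -/

theorem hTensor_φ_φ (hM : IsMetricContactPair h k α₁ α₂ φ g Z₁ Z₂) (x : M)
    (v : TangentSpace I x) :
    hTensor φ (Z₁ + Z₂) x (φ x (φ x v)) = - hTensor φ (Z₁ + Z₂) x v :=
  hM.map_φ_φ (by simp [hM.hTensor_eq, hM.contactPairStructure.apply_reeb₁])
    (by simp [hM.hTensor_eq, hM.contactPairStructure.apply_reeb₂]) v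

theorem symmPart_comp_self (hM : IsMetricContactPair h k α₁ α₂ φ g Z₁ Z₂) (x : M) :
    symmPart φ g (Z₁ + Z₂) x ∘L symmPart φ g (Z₁ + Z₂) x =
      hTensor φ (Z₁ + Z₂) x ∘L hTensor φ (Z₁ + Z₂) x := by
  ext1 v
  simp [hM.symmPart_apply, ← neg_eq_iff_eq_neg.2 (hM.hTensor_anticomm x _),
    hM.hTensor_φ_φ]

theorem leviCivita_reeb_comp_self (hM : IsMetricContactPair h k α₁ α₂ φ g Z₁ Z₂) (x : M) :
    leviCivita g (Z₁ + Z₂) x ∘L leviCivita g (Z₁ + Z₂) x =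
      hTensor φ (Z₁ + Z₂) x ∘L hTensor φ (Z₁ + Z₂) x + φ x ∘L φ x := by
  ext1 v
  simp [hM.leviCivita_reeb_apply, ← neg_eq_iff_eq_neg.2 (hM.hTensor_anticomm x _),
    hM.hTensor_φ_φ]
  abel

theorem tr_φ_comp_φ (hM : IsMetricContactPair h k α₁ α₂ φ g Z₁ Z₂) (x : M) :
    tr (φ x ∘L φ x) = - (2 * h + 2 * k) := by
  have h1 : (φ x ∘L φ x).toLinearMap = - LinearMap.id +
      (α₁ x).toLinearMap.smulRight (Z₁ x) + (α₂ x).toLinearMap.smulRight (Z₂ x) := by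
    ext v
    simp [hM.contactPairStructure.sq]
  have h2 : Module.finrank ℝ (TangentSpace I x) = 2 * h + 2 * k + 2 :=
    hM.contactPairStructure.contactPair.finrank_eq
  rw [tr, h1, map_add, map_add, map_neg, LinearMap.trace_id, LinearMap.trace_smulRight,
    LinearMap.trace_smulRight, h2]
  simp [hM.reeb.apply₁₁, hM.reeb.apply₂₂]
  ring

theorem ricciCurvature_reeb (hM : IsMetricContactPair h k α₁ α₂ φ g Z₁ Z₂) (x : M) :
    ricciCurvature g (Z₁ + Z₂) x = (h : ℝ) + k -
      (1 / 2 : ℝ) * tr (hTensor φ (Z₁ + Z₂) x ∘L hTensor φ (Z₁ + Z₂) x) := by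
  have h1 : tr (lieDerivEnd (Z₁ + Z₂) (leviCivita g (Z₁ + Z₂)) x) = 0 :=
    trace_eq_zero_of_anticomm (φ := (φ x).toLinearMap) (hM.lieDerivEnd_leviCivita_anticomm x)
      (hM.map_φ_φ (hM.lieDerivEnd_leviCivita_reeb₁ x) (hM.lieDerivEnd_leviCivita_reeb₂ x))
  have h2 : g.inner x ((Z₁ + Z₂) x) ((Z₁ + Z₂) x) = 2 := by
    norm_num [hM.inner_reeb₁, hM.inner_reeb₂, hM.reeb.apply₁₁, hM.reeb.apply₁₂, hM.reeb.apply₂₁,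
      hM.reeb.apply₂₂]
  rw [ricciCurvature, ricciTensor, h2, hM.curvatureEnd_reeb, sub_eq_add_neg, tr_add, tr_neg, tr_neg,
    h1, hM.leviCivita_reeb_comp_self, tr_add, hM.tr_φ_comp_φ]
  ring

theorem isKilling_iff (hM : IsMetricContactPair h k α₁ α₂ φ g Z₁ Z₂) :
    IsKilling g (Z₁ + Z₂) ↔ ∀ x, symmPart φ g (Z₁ + Z₂) x = 0 := by
  refine ⟨fun hK x ↦ ?_, fun hS x X Y hX hY ↦ ?_⟩
  · ext1 u
    refine eq_zero_of_inner_eq_zero g fun v ↦ ?_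
    have hu := contMDiffAt_extend (k := ∞) I E u
    have hv := contMDiffAt_extend (k := ∞) I E v
    have h1 := hM.two_mul_inner_symmPart (hu.mdifferentiableAt (by simp))
      (hv.mdifferentiableAt (by simp))
    rw [hK x _ _ hu hv] at h1
    simpa using h1
  · rw [← hM.two_mul_inner_symmPart (hX.mdifferentiableAt (by simp))
      (hY.mdifferentiableAt (by simp)), hS]
    simp

theorem symmPart_eq_zero_iff (hM : IsMetricContactPair h k α₁ α₂ φ g Z₁ Z₂) (x : M) :
    symmPart φ g (Z₁ + Z₂) x = 0 ↔
      tr (hTensor φ (Z₁ + Z₂) x ∘L hTensor φ (Z₁ + Z₂) x) = 0 := by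
  rw [← hM.symmPart_comp_self]
  refine ⟨fun h0 ↦ by simp [h0, tr], fun h0 ↦ ?_⟩
  have h1 := eq_zero_of_trace_sq_eq_zero
    (LinearMap.mk₂ ℝ (fun u v ↦ g.inner x u v) (by simp) (by simp) (by simp) (by simp))
    (g.symm x) (g.pos x) (S := (symmPart φ g (Z₁ + Z₂) x).toLinearMap) (hM.symmPart_symm x) h0
  ext1 v
  exact LinearMap.congr_fun h1 v

end IsMetricContactPair

end

end

end ContactPair

theorem mainTheorem4 (h k : ℕ)
    {M : Type*} [TopologicalSpace M] [T2Space M] [SecondCountableTopology M]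
    [ChartedSpace (EuclideanSpace ℝ (Fin (2 * h + 2 * k + 2))) M]
    [IsManifold (𝓡 (2 * h + 2 * k + 2)) ∞ M]
    (α₁ α₂ : Π x : M, TangentSpace (𝓡 (2 * h + 2 * k + 2)) x →L[ℝ] ℝ)
    (φ : Π x : M, TangentSpace (𝓡 (2 * h + 2 * k + 2)) x →L[ℝ]
      TangentSpace (𝓡 (2 * h + 2 * k + 2)) x)
    (g : Bundle.ContMDiffRiemannianMetric (𝓡 (2 * h + 2 * k + 2)) ∞
      (EuclideanSpace ℝ (Fin (2 * h + 2 * k + 2)))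
      (TangentSpace (𝓡 (2 * h + 2 * k + 2)) : M → Type _))
    (Z₁ Z₂ : Π x : M, TangentSpace (𝓡 (2 * h + 2 * k + 2)) x)
    (hM : ContactPair.IsMetricContactPair h k α₁ α₂ φ g Z₁ Z₂)
    (hφ : ContactPair.IsDecomposable α₁ α₂ φ) :
    (∀ x : M, ContactPair.ricciCurvature g (Z₁ + Z₂) x =
      (h : ℝ) + k - (1 / 2 : ℝ) * ContactPair.tr
        (ContactPair.hTensor φ (Z₁ + Z₂) x ∘L ContactPair.hTensor φ (Z₁ + Z₂) x)) ∧
    ((∀ x : M, ContactPair.ricciCurvature g (Z₁ + Z₂) x = (h : ℝ) + k) ↔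
      ContactPair.IsKilling g (Z₁ + Z₂)) := by
  refine ⟨hM.ricciCurvature_reeb, ?_⟩
  simp only [hM.isKilling_iff, hM.symmPart_eq_zero_iff, hM.ricciCurvature_reeb]
  exact forall_congr' fun x ↦ ⟨fun h0 ↦ by linarith, fun h0 ↦ by linarith⟩
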